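/- **The game.** States and actions are $\mathcal E=\mathcal A=\{C,D\}$. Each player is chosen at rate $1$; when chosen, the action she selects becomes her state, i.e. the transition rates are $Q_{ija}=\mathbf 1_{\{j=a\}}-\mathbf 1_{\{j=i\}}$. When the population distribution is $m=(m_C,m_D)$, a player has instantaneous cost $m_C+3m_D$ in state $C$ and $2m_D$ in state $D$. Costs are discounted at rate $\beta>0$, and $m_0$ is the initial distribution. *Mean field game.* A strategy is a measurable map $\pi:\mathcal E\times\mathbb R_+\to\mathcal P(\mathcal A)$. The population distribution $m^\pi$ solves $\dot m_j=\sum_{i,a}m_iQ_{ija}\pi_{i,a}(t)$, $m(0)=m_0$ (in integrated form). A player who uses $\pi^0$ has state distribution $x$ with $\dot x_j=\sum_{i,a}x_iQ_{ija}\pi^0_{i,a}(t)$, $x(0)=m_0$, and her discounted cost is $V(\pi^0,\pi)=\int_0^\infty e^{-\beta t}\sum_{i,a} x_i(t)\,c_{i,a}(m^\pi(t))\,\pi^0_{i,a}(t)\,dt$. A mean field equilibrium is a strategy $\pi$ that minimizes $V(\cdot,\pi)$. *$N$-player game.* The configuration $X(t)\in\mathcal E^N$ starts from a configuration with empirical distribution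 $m_0$. Given the past, player $n$ moves from $i$ to $j\ne i$ at rate $\sum_a Q_{ija}\,\mathbb P(A_n(t)=a)$. A Markov strategy chooses the (random) action as a measurable function of $t$, the player's own state, and the empirical distribution $M(t)$ of all players. $V^N(\pi',\pi)$ is the expected discounted cost of a player who uses $\pi'$ when all the others use $\pi$. A Markov strategy $\pi$ is a Markov Nash equilibrium if $V^N(\pi,\pi)\le V^N(\pi',\pi)$ for every player and every Markov strategy $\pi'$. **Statement.** 1. For every $\beta>0$ and every $m_0$, always playing $D$ is a mean field equilibrium, and it is the only one: if $\pi$ is a mean field equilibrium, then for almost every $t\ge0$, $\pi$ plays $D$ with probability one in each state $i$ with $m^\pi_i(t)>0$; if $m_{0,C}>0$, then for almost every $t\ge 0$, $\pi$ plays $D$ with probability one in both states. 2. Let $0<\beta<1$. For every $m_0$ there is $N_0$ such that for all $N\ge N_0$ the trigger Markov strategy $\pi^N$, "play $C$ if $m_C=1$ and $D$ if $m_C<1$", is a Markov Nash equilibrium of the $N$-player game with initial empirical distribution $m_0$. 3. Let $0<\beta<1$ and let all players start in $C$, i.e. $m_{0,C}=1$. Then $V^N(\pi^N,\pi^N)=1/\beta$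 for every $N\ge1$, whereas every mean field equilibrium has cost $\frac{\beta+2}{\beta(\beta+1)}>\frac1\beta$. Hence the values $V^N(\pi^N,\pi^N)$ do not converge to the mean field value as $N\to\infty$. -/

import Mathlib

open MeasureTheory ProbabilityTheory Filter Topology Set
open scoped NNReal

noncomputable section

/-- A discrete mean field game: transition rates `Q i j a m` (from state `i` to state `j` under
action `a` when the population distribution is `m`), instantaneous costs `c i a m`, initial
distribution `m₀`, and discount factor `β`. The rates are Lipschitz and the costs continuous on
the simplex of population distributions. -/
structure MeanFieldGame (E A : Type) [Fintype E] [Fintype A] where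
  Q : E → E → A → (E → ℝ) → ℝ
  c : E → A → (E → ℝ) → ℝ
  m₀ : E → ℝ
  β : ℝ
  rate_nonneg : ∀ i j a, i ≠ j → ∀ m ∈ stdSimplex ℝ E, 0 ≤ Q i j a m
  rate_sum : ∀ i a, ∀ m ∈ stdSimplex ℝ E, ∑ j, Q i j a m = 0
  rate_lipschitz : ∀ i j a, ∃ L : ℝ≥0, LipschitzOnWith L (Q i j a) (stdSimplex ℝ E)
  cost_continuous : ∀ i a, ContinuousOn (c i a) (stdSimplex ℝ E)
  m₀_mem : m₀ ∈ stdSimplex ℝ E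
  β_pos : 0 < β

/-- A (mixed) strategy of the mean field game: `prob i t a` is the probability of action `a` at
time `t` in state `i`. Only the times `t ≥ 0` are ever used. -/
structure LocalStrategy (E A : Type) [Fintype A] where
  prob : E → ℝ → A → ℝ
  nonneg : ∀ i t a, 0 ≤ prob i t a
  sum_eq_one : ∀ i t, ∑ a, prob i t a = 1
  measurable : ∀ i a, Measurable fun t => prob i t a

/-- A Markov strategy of the game with finitely many players: `prob t i m a` is the probability
of action `a` at time `t` for a player in state `i` when the population distribution is `m`.
Only the times `t ≥ 0` and probability vectors `m` are ever used. -/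
structure MarkovStrategy (E A : Type) [Fintype A] where
  prob : ℝ → E → (E → ℝ) → A → ℝ
  nonneg : ∀ t i m a, 0 ≤ prob t i m a
  sum_eq_one : ∀ t i m, ∑ a, prob t i m a = 1
  measurable : ∀ i a, Measurable fun p : ℝ × (E → ℝ) => prob p.1 i p.2 a

/-- The fraction of players that are in each state. -/
def empirical {E : Type} {N : ℕ} (x : Fin N → E) (i : E) : ℝ :=
  (Nat.card {n // x n = i} : ℝ) / N

/-- The information `σ(X s : s ≤ t)` generated by a process. -/
def historyFiltration {Ω S : Type} [mΩ : MeasurableSpace Ω] [mS : MeasurableSpace S]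
    (X : ℝ≥0 → Ω → S) (hX : ∀ t, Measurable (X t)) : Filtration ℝ≥0 mΩ where
  seq t := ⨆ s : ℝ≥0, ⨆ _ : s ≤ t, mS.comap (X s)
  mono' := fun _ _ hst => iSup_mono fun _ => iSup_mono' fun hr => ⟨hr.trans hst, le_rfl⟩
  le' := fun _ => iSup_le fun s => iSup_le fun _ => (hX s).comap_le

namespace MeanFieldGame

variable {E A : Type} [Fintype E] [Fintype A]

/-- `x` is the (unique, Carathéodory) solution on `[0, ∞)` of the Kolmogorov equation
`x_j' = ∑_i ∑_a x_i Q_{ija}(m(t)) π_{i,a}(t)`, `x(0) = m₀`: the state distribution of a player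
who uses `π` while the population distribution is `m`. -/
structure IsPlayerFlow (G : MeanFieldGame E A) (π : LocalStrategy E A) (m x : ℝ → E → ℝ) :
    Prop where
  mem : ∀ t, 0 ≤ t → x t ∈ stdSimplex ℝ E
  continuousOn : ContinuousOn x (Ici 0)
  eq : ∀ t, 0 ≤ t → ∀ j, x t j = G.m₀ j +
    ∫ u in (0 : ℝ)..t, ∑ i, ∑ a, x u i * G.Q i j a (m u) * π.prob i u a

/-- `m` is the population distribution when the whole population uses `π`: the solution of
`m_j' = ∑_i ∑_a m_i Q_{ija}(m) π_{i,a}`, `m(0) = m₀`. -/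
def IsPopulationFlow (G : MeanFieldGame E A) (π : LocalStrategy E A) (m : ℝ → E → ℝ) : Prop :=
  G.IsPlayerFlow π m m

/-- The discounted cost of a player with strategy `π` and state distribution `x` when the
population distribution is `m`. -/
def discountedCost (G : MeanFieldGame E A) (π : LocalStrategy E A) (m x : ℝ → E → ℝ) : ℝ :=
  ∫ t in Ioi (0 : ℝ),
    (∑ i, ∑ a, x t i * G.c i a (m t) * π.prob i t a) * Real.exp (-(G.β * t))

/-- `V(π₀, π) = v`: the discounted cost of Player 0 is `v` when she uses `π₀` and the population
uses `π`. -/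
def HasCost (G : MeanFieldGame E A) (π₀ π : LocalStrategy E A) (v : ℝ) : Prop :=
  ∃ m x, G.IsPopulationFlow π m ∧ G.IsPlayerFlow π₀ m x ∧ v = G.discountedCost π₀ m x

/-- `π₀ ∈ BR(π)`: the strategy `π₀` minimizes the discounted cost of Player 0 when the
population uses `π`. -/
def IsBestResponse (G : MeanFieldGame E A) (π₀ π : LocalStrategy E A) : Prop :=
  ∃ m x, G.IsPopulationFlow π m ∧ G.IsPlayerFlow π₀ m x ∧
    ∀ (π' : LocalStrategy E A) (y : ℝ → E → ℝ), G.IsPlayerFlow π' m y →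
      G.discountedCost π₀ m x ≤ G.discountedCost π' m y

/-- Mean field equilibrium: `π ∈ BR(π)`. -/
def IsMeanFieldEquilibrium (G : MeanFieldGame E A) (π : LocalStrategy E A) : Prop :=
  G.IsBestResponse π π

/-- Generator at time `t` of the joint state process of the players when Player `n` uses the
Markov strategy `σ n`: Player `n` jumps from `x n` to `j` at rate `∑_a Q_{x_n j a}(M) P(A_n = a)`,
where `M` is the empirical distribution. -/
def generator (G : MeanFieldGame E A) {N : ℕ} (σ : Fin N → MarkovStrategy E A) (t : ℝ)
    (f : (Fin N → E) → ℝ) (x : Fin N → E) : ℝ :=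
  ∑ n, ∑ j, ∑ a, (σ n).prob t (x n) (empirical x) a * G.Q (x n) j a (empirical x) *
    (f (Function.update x n j) - f x)

/-- `X` is the joint state process of the `N`-player game started from the configuration `ξ` when
Player `n` uses the Markov strategy `σ n`: a càdlàg pure jump process with the conditional jump
rates of `generator` given the past, in the sense of the martingale problem. (The rates are
bounded and measurable, so that such a process exists and its law is unique.) -/
structure IsStateEvolution [MeasurableSpace E] (G : MeanFieldGame E A) {N : ℕ}
    (σ : Fin N → MarkovStrategy E A) (ξ : Fin N → E) {Ω : Type} [MeasurableSpace Ω]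
    (P : Measure Ω) (X : ℝ≥0 → Ω → Fin N → E) : Prop where
  isProbabilityMeasure : IsProbabilityMeasure P
  measurable : Measurable (Function.uncurry X)
  rightCont : ∀ ω t, ∀ᶠ s in 𝓝[>] t, X s ω = X t ω
  leftLim : ∀ ω t, ∃ y, ∀ᶠ s in 𝓝[<] t, X s ω = y
  initial : ∀ᵐ ω ∂P, X 0 ω = ξ
  martingale : ∀ f : (Fin N → E) → ℝ,
    Martingale
      (fun (t : ℝ≥0) ω => f (X t ω) - ∫ s in (0 : ℝ)..t, G.generator σ s f (X s.toNNReal ω))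
      (historyFiltration X fun _ => measurable.of_uncurry_left) P

/-- `V^N(π', π) = v` for Player `n`: in the `N`-player game started from the configuration `ξ`,
whose empirical distribution has to be `m₀`, her expected discounted cost is `v` when she uses
`π'` and every other player uses `π`. -/
def HasPlayerCost [MeasurableSpace E] (G : MeanFieldGame E A) {N : ℕ} (ξ : Fin N → E) (n : Fin N)
    (π' π : MarkovStrategy E A) (v : ℝ) : Prop :=
  empirical ξ = G.m₀ ∧ ∃ (Ω : Type) (_ : MeasurableSpace Ω) (P : Measure Ω) (X : ℝ≥0 → Ω → Fin N → E),
    G.IsStateEvolution (Function.update (fun _ => π) n π') ξ P X ∧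
    v = ∫ ω, (∫ t in Ioi (0 : ℝ), Real.exp (-(G.β * t)) *
      ∑ a, π'.prob t (X t.toNNReal ω n) (empirical (X t.toNNReal ω)) a *
        G.c (X t.toNNReal ω n) a (empirical (X t.toNNReal ω))) ∂P

/-- `π` is a symmetric equilibrium, among all Markov strategies, of the `N`-player game whose
initial configuration has empirical distribution `m₀`: `V^N(π, π) ≤ V^N(π', π)` for every player
and every Markov strategy `π'`. -/
def IsMarkovEquilibrium [MeasurableSpace E] (G : MeanFieldGame E A) (N : ℕ)
    (π : MarkovStrategy E A) : Prop :=
  ∀ (ξ : Fin N → E) (n : Fin N) (π' : MarkovStrategy E A) (v v' : ℝ),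
    G.HasPlayerCost ξ n π π v → G.HasPlayerCost ξ n π' π v' → v ≤ v'

end MeanFieldGame

/-- The states, and the actions, of the prisoner's dilemma: cooperate and defect. -/
inductive Choice
  | C
  | D
  deriving DecidableEq

instance : Fintype Choice := ⟨{.C, .D}, fun i => by cases i <;> simp⟩

instance : MeasurableSpace Choice := ⊤

instance : DiscreteMeasurableSpace Choice := ⟨fun _ => trivial⟩

/-- The mean field prisoner's dilemma: each player is chosen at rate `1`, and the action that she
then selects becomes her state. The cost is `m_C + 3 m_D` in state `C` and `2 m_D` in
state `D`. -/
def prisonersDilemma (β : ℝ) (hβ : 0 < β) (m₀ : Choice → ℝ) (hm₀ : m₀ ∈ stdSimplex ℝ Choice) :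
    MeanFieldGame Choice Choice where
  Q i j a _ := (if j = a then 1 else 0) - (if j = i then 1 else 0)
  c i _ m := match i with
    | .C => m .C + 3 * m .D
    | .D => 2 * m .D
  m₀ := m₀
  β := β
  rate_nonneg i j a hij m _ := by
    rw [if_neg (Ne.symm hij)]
    split_ifs <;> norm_num
  rate_sum i a m _ := by simp
  rate_lipschitz i j a := ⟨0, (LipschitzWith.const _).lipschitzOnWith⟩
  cost_continuous i a := by
    cases i <;> exact Continuous.continuousOn (by fun_prop)
  m₀_mem := hm₀
  β_pos := hβ

/-- The distribution that gives mass `1` to `C`. -/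
def allCooperate : Choice → ℝ := Pi.single .C 1

theorem allCooperate_mem : allCooperate ∈ stdSimplex ℝ Choice :=
  single_mem_stdSimplex ℝ Choice.C

/-- The strategy of the mean field game that plays `D` in every state at every time. -/
def alwaysDefect : LocalStrategy Choice Choice where
  prob _ _ a := if a = .D then 1 else 0
  nonneg _ _ a := by split_ifs <;> norm_num
  sum_eq_one _ _ := by simp
  measurable _ _ := measurable_const

/-- The trigger strategy: play `C` if `m_C = 1`, and `D` otherwise. -/
def triggerStrategy : MarkovStrategy Choice Choice where
  prob _ _ m a := if m .C = 1 then (if a = .C then 1 else 0) else (if a = .D then 1 else 0)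
  nonneg _ _ m a := by split_ifs <;> norm_num
  sum_eq_one _ _ m := by split_ifs <;> simp
  measurable _ _ := by
    refine Measurable.ite ?_ measurable_const measurable_const
    exact (measurableSet_singleton (1 : ℝ)).preimage
      ((measurable_pi_apply Choice.C).comp measurable_snd)

end

/-! In the mean field game the action of a single player does not influence the population, and the
cost `x_C + 2 m_D` of a player with state distribution `x` depends on her own behaviour through
`x_C` only. Whatever she does, `x_C` solves `x_C' = u - x_C` with the cooperation rate `u ≥ 0`, so
that `x_C(t) ≥ e^{-t} (x_C(0) + ∫_0^t u)` (`exp_mul_le_flow_C`). Hence always defecting is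
optimal against any population, and a strategy is optimal only if `u = 0` almost everywhere
(`equilibrium_flow`).

With finitely many players everything follows from a discounted Dynkin formula for the martingale
problem, `E ∫ e^{-βt} (β f - L_t f)(X_t) dt = f(ξ)` (`integral_discounted_generator`), applied to
explicit functions `f` of the configuration. If everybody defects forever, the cost of Player `n`
from the configuration `x` on is
`2 / β + (1_{x_n = C} - 2 m_C) / (β + 1)` (`defectValue`). When all use the trigger
strategy, the cost is this value, except that it is `1 / β` when all players are in `C`
(`triggerValue`). For a deviating player, the function that equals `1 / β` as long as
all the *others* are in `C`, and the former value otherwise (`deviationValue`), is a subsolution of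
the dynamic programming equation. The critical configuration is the one where she alone is
in `D`. By returning to `C` she may restore the mutual cooperation, but meanwhile one of the other
`N - 1` players reacts at rate `N - 1`, which raises her cost from `1 / β` to about
`2 / (β (β + 1))`. This is a loss since `β < 1`, and it outweighs the gain for `N` large. The values
`triggerValue` and `deviationValue` agree at the initial configuration unless the deviating player
is the only one in `D` there. For a fixed initial distribution, large populations rule this out,
as they have either no player in `D` or at least two. -/

/-! ### Discounted integrals -/

theorem integrableOn_exp_neg_mul_Ioi {β : ℝ} (hβ : 0 < β) (a : ℝ) :
    IntegrableOn (fun t => Real.exp (-(β * t))) (Ioi a) := by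
  simpa [neg_mul] using exp_neg_integrableOn_Ioi a hβ

theorem integral_exp_neg_mul_Ioi {β : ℝ} (hβ : 0 < β) (a : ℝ) :
    ∫ t in Ioi a, Real.exp (-(β * t)) = Real.exp (-(β * a)) / β := by
  have h := integral_exp_mul_Ioi (a := -β) (by linarith) a
  simp only [neg_mul] at h
  rw [h, neg_div_neg_eq]

/-- The integration by parts `∫ e^{-βt} (β h - h') dt = h 0` for a primitive `h` of a bounded
measurable function `ℓ`. As `h` need only be differentiable almost everywhere, it is deduced from
Fubini's theorem on `{s ≤ t}`. -/
theorem integral_exp_mul_primitive {β : ℝ} (hβ : 0 < β) {ℓ h : ℝ → ℝ} {K a : ℝ}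
    (hℓ : Measurable ℓ) (hK : ∀ t, |ℓ t| ≤ K)
    (hh : ∀ t, 0 ≤ t → h t = a + ∫ s in (0 : ℝ)..t, ℓ s) :
    ∫ t in Ioi (0 : ℝ), Real.exp (-(β * t)) * (β * h t - ℓ t) = a := by
  set μ : Measure ℝ := volume.restrict (Ioi 0) with hμ
  have hexp : Integrable (fun t => Real.exp (-(β * t))) μ := integrableOn_exp_neg_mul_Ioi hβ 0
  have hℓexp : Integrable (fun s => Real.exp (-(β * s)) * ℓ s) μ :=
    hexp.mul_bdd hℓ.aestronglyMeasurable (Eventually.of_forall hK)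
  let F : ℝ × ℝ → ℝ := fun p => (Ici p.2).indicator (fun t => β * Real.exp (-(β * t)) * ℓ p.2) p.1
  have hFm : Measurable F := by
    have : F = {p : ℝ × ℝ | p.2 ≤ p.1}.indicator
        (fun p => β * Real.exp (-(β * p.1)) * ℓ p.2) := by
      ext p
      simp [F, indicator]
    rw [this]
    exact Measurable.indicator (by fun_prop) (measurableSet_le measurable_snd measurable_fst)
  have hinner : ∀ s ∈ Ioi (0 : ℝ), ∀ c : ℝ,
      ∫ t, (Ici s).indicator (fun t => β * Real.exp (-(β * t)) * c) t ∂μ =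
        Real.exp (-(β * s)) * c := by
    intro s hs c
    rw [integral_indicator measurableSet_Ici, hμ, Measure.restrict_restrict measurableSet_Ici,
      inter_eq_left.2 (Ici_subset_Ioi.2 hs), integral_Ici_eq_integral_Ioi,
      integral_mul_const, integral_const_mul, integral_exp_neg_mul_Ioi hβ]
    field_simp
  have hF : Integrable F (μ.prod μ) := by
    rw [integrable_prod_iff' hFm.aestronglyMeasurable]
    constructor
    · exact Eventually.of_forall fun s =>
        ((hexp.const_mul β).mul_const (ℓ s)).indicator (s := Ici s) measurableSet_Ici
    · have : (fun s => ∫ t, ‖F (t, s)‖ ∂μ) =ᵐ[μ] fun s => Real.exp (-(β * s)) * |ℓ s| := by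
        filter_upwards [ae_restrict_mem measurableSet_Ioi] with s hs
        rw [← hinner s hs]
        refine integral_congr_ae (Eventually.of_forall fun t => ?_)
        simp only [F, norm_indicator_eq_indicator_norm, norm_mul, Real.norm_eq_abs,
          abs_of_pos hβ, Real.abs_exp]
      rw [integrable_congr this]
      exact hexp.mul_bdd hℓ.abs.aestronglyMeasurable
        (Eventually.of_forall fun s => by simpa using hK s)
  have houter : ∀ t ∈ Ioi (0 : ℝ), ∫ s, F (t, s) ∂μ =
      Real.exp (-(β * t)) * (β * h t) - a * (β * Real.exp (-(β * t))) := by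
    intro t ht
    have : (fun s => F (t, s)) =
        (Iic t).indicator (fun s => β * Real.exp (-(β * t)) * ℓ s) := by
      ext s
      simp [F, indicator]
    rw [this, integral_indicator measurableSet_Iic, hμ, Measure.restrict_restrict measurableSet_Iic,
      inter_comm, Ioi_inter_Iic, integral_const_mul, ← intervalIntegral.integral_of_le (le_of_lt ht),
      hh t (le_of_lt ht)]
    ring
  have hswap := integral_integral_swap (f := fun t s => F (t, s)) hF
  have hright : ∫ s, ∫ t, F (t, s) ∂μ ∂μ = ∫ s, Real.exp (-(β * s)) * ℓ s ∂μ :=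
    setIntegral_congr_fun measurableSet_Ioi fun s hs => hinner s hs (ℓ s)
  have hleft : ∫ t, ∫ s, F (t, s) ∂μ ∂μ =
      ∫ t, Real.exp (-(β * t)) * (β * h t) - a * (β * Real.exp (-(β * t))) ∂μ :=
    setIntegral_congr_fun measurableSet_Ioi houter
  have haexp : Integrable (fun t => a * (β * Real.exp (-(β * t)))) μ :=
    (hexp.const_mul β).const_mul a
  have hhexp : Integrable (fun t => Real.exp (-(β * t)) * (β * h t)) μ := by
    have h1 : Integrable (fun t => ∫ s, F (t, s) ∂μ) μ := hF.integral_prod_left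
    have h2 := (integrable_congr (ae_restrict_of_forall_mem measurableSet_Ioi houter)).1 h1
    exact (h2.add haexp).congr (Eventually.of_forall fun t => by simp)
  have hone : ∫ t, a * (β * Real.exp (-(β * t))) ∂μ = a := by
    rw [integral_const_mul, integral_const_mul, hμ, integral_exp_neg_mul_Ioi hβ]
    simp only [mul_zero, neg_zero, Real.exp_zero]
    field_simp
  rw [hleft, hright, integral_sub hhexp haexp, hone] at hswap
  simp only [mul_sub]
  rw [integral_sub hhexp hℓexp]
  linarith

/-! ### The discounted Dynkin formula and the verification argument -/

namespace MarkovStrategy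

theorem prob_le_one {E A : Type} [Fintype A] (π : MarkovStrategy E A) (t : ℝ) (i : E) (m : E → ℝ)
    (a : A) : π.prob t i m a ≤ 1 :=
  (Finset.single_le_sum (fun b _ => π.nonneg t i m b) (Finset.mem_univ a)).trans_eq
    (π.sum_eq_one t i m)

theorem measurable_time {E A : Type} [Fintype A] (π : MarkovStrategy E A) (i : E) (m : E → ℝ) (a : A) :
    Measurable fun t => π.prob t i m a :=
  (π.measurable i a).comp (measurable_id.prodMk measurable_const)

end MarkovStrategy

namespace MeanFieldGame

variable {E A : Type} [Fintype E] [Fintype A]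

theorem measurable_generator (G : MeanFieldGame E A) {N : ℕ} (σ : Fin N → MarkovStrategy E A)
    (f : (Fin N → E) → ℝ) (x : Fin N → E) : Measurable fun t => G.generator σ t f x := by
  unfold generator
  refine Finset.measurable_sum _ fun n _ => Finset.measurable_sum _ fun j _ =>
    Finset.measurable_sum _ fun a _ => ?_
  exact (((σ n).measurable_time _ _ _).mul_const _).mul_const _

theorem exists_generator_bound (G : MeanFieldGame E A) {N : ℕ} (σ : Fin N → MarkovStrategy E A)
    (f : (Fin N → E) → ℝ) : ∃ K, ∀ t x, |G.generator σ t f x| ≤ K := by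
  classical
  let B : (Fin N → E) → ℝ := fun x => ∑ n, ∑ j, ∑ a,
    |G.Q (x n) j a (empirical x) * (f (Function.update x n j) - f x)|
  have hB : ∀ x, 0 ≤ B x := fun x => by positivity
  refine ⟨∑ x, B x, fun t x => le_trans ?_ (Finset.single_le_sum (fun y _ => hB y)
    (Finset.mem_univ x))⟩
  unfold generator
  refine (Finset.abs_sum_le_sum_abs _ _).trans (Finset.sum_le_sum fun n _ => ?_)
  refine (Finset.abs_sum_le_sum_abs _ _).trans (Finset.sum_le_sum fun j _ => ?_)
  refine (Finset.abs_sum_le_sum_abs _ _).trans (Finset.sum_le_sum fun a _ => ?_)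
  rw [mul_assoc, abs_mul, abs_of_nonneg ((σ n).nonneg _ _ _ _)]
  convert mul_le_of_le_one_left (abs_nonneg _) ((σ n).prob_le_one t (x n) (empirical x) a)

variable [MeasurableSpace E] [MeasurableSingletonClass E]

namespace IsStateEvolution

variable {G : MeanFieldGame E A} {N : ℕ} {σ : Fin N → MarkovStrategy E A} {ξ : Fin N → E}
  {Ω : Type} [MeasurableSpace Ω] {P : Measure Ω} {X : ℝ≥0 → Ω → Fin N → E}

theorem measurable_comp (hX : G.IsStateEvolution σ ξ P X) {φ : ℝ → (Fin N → E) → ℝ}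
    (hφ : ∀ x, Measurable fun t => φ t x) :
    Measurable fun p : ℝ × Ω => φ p.1 (X p.1.toNNReal p.2) := by
  have h1 : Measurable fun q : ℝ × (Fin N → E) => φ q.1 q.2 :=
    measurable_from_prod_countable_left hφ
  have h2 : Measurable fun p : ℝ × Ω => Function.uncurry X (p.1.toNNReal, p.2) :=
    hX.measurable.comp ((measurable_real_toNNReal.comp measurable_fst).prodMk measurable_snd)
  exact h1.comp (measurable_fst.prodMk h2)

theorem integrable_discounted (hX : G.IsStateEvolution σ ξ P X) {φ : ℝ → (Fin N → E) → ℝ}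
    (hφ : ∀ x, Measurable fun t => φ t x) {K : ℝ} (hK : ∀ t x, |φ t x| ≤ K) :
    Integrable (fun p : ℝ × Ω => Real.exp (-(G.β * p.1)) * φ p.1 (X p.1.toNNReal p.2))
      ((volume.restrict (Ioi 0)).prod P) := by
  have := hX.isProbabilityMeasure
  have h1 : Integrable (fun t => Real.exp (-(G.β * t))) (volume.restrict (Ioi 0)) :=
    integrableOn_exp_neg_mul_Ioi G.β_pos 0
  exact (h1.comp_fst P).mul_bdd (hX.measurable_comp hφ).aestronglyMeasurable
    (Eventually.of_forall fun p => hK _ _)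

theorem integral_eq (hX : G.IsStateEvolution σ ξ P X) (f : (Fin N → E) → ℝ) {t : ℝ} (ht : 0 ≤ t) :
    ∫ ω, f (X t.toNNReal ω) ∂P =
      f ξ + ∫ s in (0 : ℝ)..t, ∫ ω, G.generator σ s f (X s.toNNReal ω) ∂P := by
  have := hX.isProbabilityMeasure
  obtain ⟨K, hK⟩ := G.exists_generator_bound σ f
  have hmeas := hX.measurable_comp (G.measurable_generator σ f)
  have hint : Integrable (fun p : ℝ × Ω => G.generator σ p.1 f (X p.1.toNNReal p.2))
      ((volume.restrict (Ioc 0 t)).prod P) :=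
    Integrable.of_bound hmeas.aestronglyMeasurable K (Eventually.of_forall fun p => hK _ _)
  have hfX : Integrable (fun ω => f (X t.toNNReal ω)) P := by
    obtain ⟨C, hC⟩ := (Set.finite_range fun x => |f x|).bddAbove
    refine Integrable.of_bound (C := C) ?_ (Eventually.of_forall fun ω => hC ⟨_, rfl⟩)
    exact ((measurable_of_countable f).comp
      hX.measurable.of_uncurry_left).aestronglyMeasurable
  have h := (hX.martingale f).setIntegral_eq (zero_le (a := t.toNNReal)) MeasurableSet.univ
  simp only [setIntegral_univ, NNReal.coe_zero, intervalIntegral.integral_same, sub_zero,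
    Real.coe_toNNReal t ht] at h
  have h0 : ∫ ω, f (X 0 ω) ∂P = f ξ := by
    rw [integral_congr_ae (hX.initial.mono fun ω hω => congrArg f hω)]
    simp
  simp only [intervalIntegral.integral_of_le ht] at h ⊢
  rw [h0, integral_sub hfX hint.integral_prod_right,
    ← integral_integral_swap (f := fun s ω => G.generator σ s f (X s.toNNReal ω)) hint] at h
  linarith

/-- Dynkin's formula, discounted: the expectation of `∫ e^{-βt} (β f - L f)(X_t) dt` is the
initial value of `f`. -/
theorem integral_discounted_generator (hX : G.IsStateEvolution σ ξ P X) (f : (Fin N → E) → ℝ) :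
    ∫ ω, (∫ t in Ioi (0 : ℝ), Real.exp (-(G.β * t)) *
      (G.β * f (X t.toNNReal ω) - G.generator σ t f (X t.toNNReal ω))) ∂P = f ξ := by
  have := hX.isProbabilityMeasure
  obtain ⟨K, hK⟩ := G.exists_generator_bound σ f
  obtain ⟨C, hC⟩ := (Set.finite_range fun x => |G.β * f x|).bddAbove
  have hφ : ∀ x, Measurable fun t => G.β * f x - G.generator σ t f x := fun x =>
    measurable_const.sub (G.measurable_generator σ f x)
  have hbd : ∀ t x, |G.β * f x - G.generator σ t f x| ≤ C + K := fun t x =>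
    (abs_sub _ _).trans (add_le_add (hC ⟨x, rfl⟩) (hK t x))
  have hint := hX.integrable_discounted hφ hbd
  rw [← integral_integral_swap (f := fun t ω => Real.exp (-(G.β * t)) *
      (G.β * f (X t.toNNReal ω) - G.generator σ t f (X t.toNNReal ω))) hint]
  have hfX : ∀ t : ℝ, Integrable (fun ω => G.β * f (X t.toNNReal ω)) P := fun t =>
    Integrable.of_bound (C := C) ((measurable_of_countable fun x => G.β * f x).comp
      hX.measurable.of_uncurry_left).aestronglyMeasurable
      (Eventually.of_forall fun ω => hC ⟨_, rfl⟩)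
  have hmeas := hX.measurable_comp (G.measurable_generator σ f)
  have hgX : ∀ t : ℝ, Integrable (fun ω => G.generator σ t f (X t.toNNReal ω)) P := fun t =>
    Integrable.of_bound (C := K) (hmeas.comp measurable_prodMk_left).aestronglyMeasurable
      (Eventually.of_forall fun ω => hK _ _)
  rw [← integral_exp_mul_primitive G.β_pos (K := K)
    (ℓ := fun t => ∫ ω, G.generator σ t f (X t.toNNReal ω) ∂P)
    hmeas.stronglyMeasurable.integral_prod_right.measurable
    (fun t => by
      simpa using norm_integral_le_of_norm_le_const (μ := P) (C := K)
        (f := fun ω => G.generator σ t f (X t.toNNReal ω))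
        (Eventually.of_forall fun ω => hK t (X t.toNNReal ω)))
    (fun t ht => hX.integral_eq f ht)]
  congr 1 with t
  rw [integral_const_mul, integral_sub (hfX t) (hgX t), integral_const_mul]

/-- The verification argument: a subsolution `f` of the dynamic programming equation with running
cost `φ` bounds the expected discounted cost from below. -/
theorem le_integral_discounted (hX : G.IsStateEvolution σ ξ P X) {φ : ℝ → (Fin N → E) → ℝ}
    (hφ : ∀ x, Measurable fun t => φ t x) {K : ℝ} (hK : ∀ t x, |φ t x| ≤ K)
    {f : (Fin N → E) → ℝ} (hf : ∀ t x, G.β * f x - G.generator σ t f x ≤ φ t x) :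
    f ξ ≤ ∫ ω, (∫ t in Ioi (0 : ℝ), Real.exp (-(G.β * t)) * φ t (X t.toNNReal ω)) ∂P := by
  have := hX.isProbabilityMeasure
  obtain ⟨K', hK'⟩ := G.exists_generator_bound σ f
  obtain ⟨C, hC⟩ := (Set.finite_range fun x => |G.β * f x|).bddAbove
  have h1 := hX.integrable_discounted (φ := fun t x => G.β * f x - G.generator σ t f x)
    (fun x => measurable_const.sub (G.measurable_generator σ f x))
    (fun t x => (abs_sub _ _).trans (add_le_add (hC ⟨x, rfl⟩) (hK' t x)))
  have h2 := hX.integrable_discounted hφ hK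
  rw [← hX.integral_discounted_generator f]
  refine integral_mono_ae h1.integral_prod_right h2.integral_prod_right ?_
  filter_upwards [h1.prod_left_ae, h2.prod_left_ae] with ω hω1 hω2
  exact integral_mono hω1 hω2 fun t => mul_le_mul_of_nonneg_left (hf t _) (Real.exp_pos _).le

end IsStateEvolution

end MeanFieldGame

/-! ### The prisoner's dilemma with finitely many players -/

theorem Choice.univ_eq : (Finset.univ : Finset Choice) = {.C, .D} := rfl

theorem Choice.sum_eq (f : Choice → ℝ) : ∑ i, f i = f .C + f .D := by
  rw [Choice.univ_eq, Finset.sum_pair (by decide)]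

section Empirical

variable {N : ℕ}

theorem empirical_eq_sum (x : Fin N → Choice) (i : Choice) :
    empirical x i = (∑ m, if x m = i then (1 : ℝ) else 0) / N := by
  rw [empirical, Finset.sum_boole, Nat.card_eq_fintype_card, Fintype.card_subtype]

theorem empirical_D [NeZero N] (x : Fin N → Choice) : empirical x .D = 1 - empirical x .C := by
  have hN : (N : ℝ) ≠ 0 := NeZero.ne _
  have h : (∑ m, if x m = .D then (1 : ℝ) else 0) + (∑ m, if x m = .C then (1 : ℝ) else 0) = N := by
    rw [← Finset.sum_add_distrib, Finset.sum_congr rfl (g := fun _ => (1 : ℝ))]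
    · simp
    · intro m _
      cases x m <;> simp
  rw [empirical_eq_sum, empirical_eq_sum, eq_sub_iff_add_eq, ← add_div, h, div_self hN]

theorem empirical_update (x : Fin N → Choice) (m : Fin N) (a i : Choice) :
    empirical (Function.update x m a) i = empirical x i +
      ((if a = i then 1 else 0) - (if x m = i then 1 else 0)) / N := by
  rw [empirical_eq_sum, empirical_eq_sum, ← add_div]
  congr 1
  rw [← Finset.add_sum_erase _ _ (Finset.mem_univ m), ← Finset.add_sum_erase _ _ (Finset.mem_univ m),
    Finset.sum_congr (g := fun k => if x k = i then (1 : ℝ) else 0) rfl fun k hk => by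
      rw [Function.update_of_ne (Finset.ne_of_mem_erase hk)]]
  rw [Function.update_self]
  ring

theorem empirical_C_eq_one_iff [NeZero N] (x : Fin N → Choice) :
    empirical x .C = 1 ↔ ∀ m, x m = .C := by
  have hN : (N : ℝ) ≠ 0 := NeZero.ne _
  rw [empirical_eq_sum, div_eq_one_iff_eq hN]
  refine ⟨fun h => ?_, fun h => by simp [h]⟩
  by_contra! hx
  obtain ⟨m, hm⟩ := hx
  have : (∑ m, if x m = .C then (1 : ℝ) else 0) < ∑ _m : Fin N, (1 : ℝ) :=
    Finset.sum_lt_sum (fun k _ => by split_ifs <;> norm_num) ⟨m, Finset.mem_univ m, by simp [hm]⟩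
  simp at this h
  linarith

theorem empirical_const_C [NeZero N] : empirical (fun _ : Fin N => Choice.C) = allCooperate := by
  ext i
  cases i
  · rw [(empirical_C_eq_one_iff _).2 fun _ => rfl]
    simp [allCooperate]
  · rw [empirical_D, (empirical_C_eq_one_iff _).2 fun _ => rfl]
    simp [allCooperate]

end Empirical

namespace PrisonersDilemma

open MeanFieldGame

variable {β : ℝ} {hβ : 0 < β} {m₀ : Choice → ℝ} {hm₀ : m₀ ∈ stdSimplex ℝ Choice} {N : ℕ}

theorem generator_eq (σ : Fin N → MarkovStrategy Choice Choice) (t : ℝ)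
    (f : (Fin N → Choice) → ℝ) (x : Fin N → Choice) :
    (prisonersDilemma β hβ m₀ hm₀).generator σ t f x =
      ∑ m, ∑ a, (σ m).prob t (x m) (empirical x) a * (f (Function.update x m a) - f x) := by
  unfold generator
  refine Finset.sum_congr rfl fun m _ => ?_
  rw [Finset.sum_comm]
  refine Finset.sum_congr rfl fun a _ => ?_
  have h : f (Function.update x m (x m)) = f x := by rw [Function.update_eq_self]
  simp only [prisonersDilemma, Choice.sum_eq]
  rcases hx : x m <;> rw [hx] at h <;> cases a <;> simp [h]

/-- The instantaneous cost `1_{x_n = C} + 2 m_D` of Player `n` in the configuration `x`, where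
`m_D` is written as `1 - m_C`. -/
noncomputable def playerCost (n : Fin N) (x : Fin N → Choice) : ℝ :=
  (if x n = .C then 1 else 0) + 2 - 2 * empirical x .C

theorem sum_prob_mul_cost [NeZero N] (π : MarkovStrategy Choice Choice) (n : Fin N) (t : ℝ)
    (x : Fin N → Choice) :
    ∑ a, π.prob t (x n) (empirical x) a *
      (prisonersDilemma β hβ m₀ hm₀).c (x n) a (empirical x) = playerCost n x := by
  have hc : ∀ a, (prisonersDilemma β hβ m₀ hm₀).c (x n) a (empirical x) = playerCost n x := by
    intro a
    simp only [prisonersDilemma, playerCost]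
    rcases x n <;> simp only [empirical_D, reduceCtorEq, if_true, if_false] <;> ring
  simp only [hc, ← Finset.sum_mul, π.sum_eq_one, one_mul]

theorem exists_playerCost_bound (n : Fin N) : ∃ K, ∀ x, |playerCost n x| ≤ K := by
  obtain ⟨K, hK⟩ := (Set.finite_range fun x => |playerCost n x|).bddAbove
  exact ⟨K, fun x => hK ⟨x, rfl⟩⟩

theorem triggerStrategy_prob_of_eq {m : Choice → ℝ} (h : m .C = 1) (t : ℝ) (i a : Choice) :
    triggerStrategy.prob t i m a = if a = .C then 1 else 0 := by
  simp [triggerStrategy, h]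

theorem triggerStrategy_prob_of_ne {m : Choice → ℝ} (h : m .C ≠ 1) (t : ℝ) (i a : Choice) :
    triggerStrategy.prob t i m a = if a = .D then 1 else 0 := by
  simp [triggerStrategy, h]

/-- The expected discounted cost of Player `n` from the configuration `x` on when all players
defect forever. -/
noncomputable def defectValue (β : ℝ) (n : Fin N) (x : Fin N → Choice) : ℝ :=
  2 / β + ((if x n = .C then 1 else 0) - 2 * empirical x .C) / (β + 1)

theorem defectValue_update_sub (β : ℝ) (n m : Fin N) (x : Fin N → Choice) (a : Choice) :
    defectValue β n (Function.update x m a) - defectValue β n x =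
      ((if a = .C then 1 else 0) - (if x m = .C then 1 else 0)) *
        ((if m = n then 1 else 0) - 2 / N) / (β + 1) := by
  simp only [defectValue, empirical_update]
  by_cases h : m = n
  · subst h
    simp only [Function.update_self, if_true]
    ring
  · rw [Function.update_of_ne (Ne.symm h), if_neg h]
    ring

theorem sum_defectValue_update_sub (β : ℝ) (n : Fin N) (x : Fin N → Choice) :
    ∑ m, (defectValue β n (Function.update x m .D) - defectValue β n x) =
      -((if x n = .C then 1 else 0) - 2 * empirical x .C) / (β + 1) := by
  have h : ∀ m, defectValue β n (Function.update x m .D) - defectValue β n x =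
      ((if x m = .C then 1 else 0) * (2 / N) - (if m = n then (if x m = .C then 1 else 0) else 0)) /
        (β + 1) := by
    intro m
    rw [defectValue_update_sub]
    by_cases hm : m = n <;> simp only [hm, if_true, if_false, reduceCtorEq] <;> ring
  rw [Finset.sum_congr rfl fun m _ => h m, ← Finset.sum_div, Finset.sum_sub_distrib,
    ← Finset.sum_mul, Finset.sum_ite_eq' Finset.univ n, if_pos (Finset.mem_univ n),
    empirical_eq_sum]
  ring

/-- The second summand on the right is the value of the generator at `defectValue` when everybody
defects, see `sum_defectValue_update_sub`. -/
theorem mul_defectValue (hβ : 0 < β) (n : Fin N) (x : Fin N → Choice) :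
    β * defectValue β n x = playerCost n x +
      -((if x n = .C then 1 else 0) - 2 * empirical x .C) / (β + 1) := by
  have h1 : β + 1 ≠ 0 := by positivity
  simp only [defectValue, playerCost]
  field_simp
  ring

/-- The expected discounted cost of Player `n` from the configuration `x` on when everybody,
including her, uses the trigger strategy. -/
noncomputable def triggerValue (β : ℝ) (n : Fin N) (x : Fin N → Choice) : ℝ :=
  if ∀ m, x m = .C then 1 / β else defectValue β n x

/-- A lower bound for the expected discounted cost of Player `n` from the configuration `x` on
when the others use the trigger strategy. While all the others cooperate, defecting does not
lower it below the value `1 / β` of mutual cooperation. -/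
noncomputable def deviationValue (β : ℝ) (n : Fin N) (x : Fin N → Choice) : ℝ :=
  if ∀ m, m ≠ n → x m = .C then 1 / β else defectValue β n x

theorem playerCost_of_forall_eq [NeZero N] (n : Fin N) {x : Fin N → Choice}
    (hx : ∀ m, x m = .C) : playerCost n x = 1 := by
  rw [playerCost, (empirical_C_eq_one_iff x).2 hx, if_pos (hx n)]
  norm_num

/-- The dynamic programming equation when everybody uses the trigger strategy. It holds for every
`N ≥ 1` and in every configuration, since no jump leads to the configuration of all cooperators. -/
theorem triggerValue_equation [NeZero N] (n : Fin N) (t : ℝ) (x : Fin N → Choice) :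
    β * triggerValue β n x - (prisonersDilemma β hβ m₀ hm₀).generator (fun _ => triggerStrategy) t
      (triggerValue β n) x = playerCost n x := by
  rw [generator_eq]
  by_cases hx : ∀ m, x m = .C
  · have hC := (empirical_C_eq_one_iff x).2 hx
    have hupd : ∀ m, Function.update x m .C = x := fun m => by
      rw [← hx m, Function.update_eq_self]
    rw [Finset.sum_eq_zero]
    · rw [triggerValue, if_pos hx, playerCost_of_forall_eq n hx]
      field_simp
      ring
    · intro m _
      simp [triggerStrategy_prob_of_eq hC, hupd]
  · have hC := mt (empirical_C_eq_one_iff x).1 hx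
    have hupd : ∀ m, ¬ ∀ k, Function.update x m .D k = .C := fun m h => by
      simpa using h m
    rw [Finset.sum_congr (g := fun m => defectValue β n (Function.update x m .D) -
      defectValue β n x) rfl fun m _ => by
        simp [triggerStrategy_prob_of_ne hC, triggerValue, hx, hupd m],
      sum_defectValue_update_sub, triggerValue, if_neg hx, mul_defectValue hβ]
    ring

/-- In a large population, the jumps of the `N - 1` others to `D` after a single defection raise the
cost of the defector at a total rate of at least `1 = β * (1 / β)`, the rate at which the value of
mutual cooperation is discounted. -/
theorem one_le_defection_loss (hβ : 0 < β) (hβ1 : β < 1)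
    (hN : β * (β + 1) / (1 - β) + 1 ≤ N) :
    1 ≤ ((N : ℝ) - 1) * (2 / β - 2 / (β + 1) - 1 / β) := by
  have h1 : 0 < 1 - β := by linarith
  have h2 : 2 / β - 2 / (β + 1) - 1 / β = (1 - β) / (β * (β + 1)) := by
    field_simp
    ring
  have h3 : β * (β + 1) / (1 - β) ≤ (N : ℝ) - 1 := by linarith
  rw [h2, ← mul_div_assoc, one_le_div (by positivity)]
  rwa [div_le_iff₀ h1] at h3

/-- The dynamic programming inequality for a player who deviates from the trigger strategy in an
arbitrary way. -/
theorem deviationValue_subsolution [NeZero N] (hβ1 : β < 1) (hN2 : 2 ≤ N)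
    (hN : β * (β + 1) / (1 - β) + 1 ≤ N) (n : Fin N) (π' : MarkovStrategy Choice Choice) (t : ℝ)
    (x : Fin N → Choice) :
    β * deviationValue β n x - (prisonersDilemma β hβ m₀ hm₀).generator
      (Function.update (fun _ => triggerStrategy) n π') t (deviationValue β n) x ≤
        playerCost n x := by
  have hNr : (2 : ℝ) ≤ N := by exact_mod_cast hN2
  have hN0 : (0 : ℝ) < N := by linarith
  rw [generator_eq]
  by_cases hx : ∀ m, m ≠ n → x m = .C
  · have hself : ∀ a, deviationValue β n (Function.update x n a) = 1 / β := fun a => by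
      rw [deviationValue, if_pos]
      exact fun m hm => by rw [Function.update_of_ne hm, hx m hm]
    have hval : deviationValue β n x = 1 / β := by rw [deviationValue, if_pos hx]
    -- her own jumps do not change the value here, whatever she plays
    by_cases hn : x n = .C
    · have hall : ∀ m, x m = .C := fun m => by
        by_cases hm : m = n
        · rw [hm, hn]
        · exact hx m hm
      have hC := (empirical_C_eq_one_iff x).2 hall
      rw [playerCost_of_forall_eq n hall, hval, Finset.sum_eq_zero]
      · field_simp
        norm_num
      · intro m _
        by_cases hm : m = n
        · subst hm
          simp only [hself, sub_self, mul_zero, Finset.sum_const_zero]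
        · have hupd : Function.update x m .C = x := by rw [← hall m, Function.update_eq_self]
          simp [Function.update_of_ne hm, triggerStrategy_prob_of_eq hC, hupd, hval]
    · have hC : empirical x .C ≠ 1 := fun h => hn ((empirical_C_eq_one_iff x).1 h n)
      have hle : empirical x .C ≤ 1 := by
        rw [empirical_eq_sum, div_le_one hN0]
        calc _ ≤ ∑ _m : Fin N, (1 : ℝ) :=
              Finset.sum_le_sum fun m _ => by split_ifs <;> norm_num
          _ = N := by simp
      -- she is the only one in `D`: the `N - 1` others are about to react
      rw [← Finset.add_sum_erase _ _ (Finset.mem_univ n)]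
      have hfirst : ∑ a, (Function.update (fun _ => triggerStrategy) n π' n).prob t (x n)
          (empirical x) a * (deviationValue β n (Function.update x n a) -
            deviationValue β n x) = 0 := by
        simp [hself, hval]
      have hrest : ∀ m ∈ Finset.univ.erase n, 2 / β - 2 / (β + 1) - 1 / β ≤
          ∑ a, (Function.update (fun _ => triggerStrategy) n π' m).prob t (x m)
          (empirical x) a * (deviationValue β n (Function.update x m a) -
            deviationValue β n x) := by
        intro m hm
        have hmn := Finset.ne_of_mem_erase hm
        have hupd : ¬ ∀ k, k ≠ n → Function.update x m .D k = .C := fun h => by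
          simpa using h m hmn
        have hemp : empirical (Function.update x m .D) .C ≤ 1 := by
          rw [empirical_update, hx m hmn]
          have : (0 : ℝ) < 1 / N := by positivity
          simp only [reduceCtorEq, if_true, if_false, zero_sub, neg_div]
          linarith
        simp only [Choice.sum_eq, Function.update_of_ne hmn, triggerStrategy_prob_of_ne hC,
          reduceCtorEq, if_true, if_false, zero_mul, one_mul, zero_add, hval]
        rw [deviationValue, if_neg hupd, defectValue, Function.update_of_ne hmn.symm, if_neg hn]
        have : 2 * empirical (Function.update x m .D) .C / (β + 1) ≤ 2 / (β + 1) := by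
          gcongr
          linarith
        rw [zero_sub, neg_div]
        linarith
      have hsum := Finset.card_nsmul_le_sum _ _ _ hrest
      rw [Finset.card_erase_of_mem (Finset.mem_univ n), Finset.card_univ, Fintype.card_fin,
        nsmul_eq_mul, Nat.cast_pred (by omega)] at hsum
      have hloss := one_le_defection_loss hβ hβ1 hN
      have hcost : 0 ≤ playerCost n x := by
        rw [playerCost, if_neg hn]
        linarith
      have hone : β * (1 / β) = 1 := by field_simp
      rw [hfirst, hval, hone]
      rw [hval] at hsum
      linarith
  -- some other player is in `D` for good, so that the others defect forever
  · have hval : deviationValue β n x = defectValue β n x := by rw [deviationValue, if_neg hx]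
    have hC : empirical x .C ≠ 1 := fun h =>
      hx fun m _ => (empirical_C_eq_one_iff x).1 h m
    have hself : ∀ a, deviationValue β n (Function.update x n a) =
        defectValue β n (Function.update x n a) := fun a => by
      rw [deviationValue, if_neg]
      intro h
      exact hx fun m hm => by simpa [Function.update_of_ne hm] using h m hm
    have hterm : ∀ m, defectValue β n (Function.update x m .D) - defectValue β n x ≤
        ∑ a, (Function.update (fun _ => triggerStrategy) n π' m).prob t (x m)
          (empirical x) a * (deviationValue β n (Function.update x m a) -
            deviationValue β n x) := by
      intro m
      by_cases hm : m = n
      · subst hm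
        have hsum := π'.sum_eq_one t (x m) (empirical x)
        have hpos := π'.nonneg t (x m) (empirical x) .C
        rw [Choice.sum_eq] at hsum ⊢
        rw [Function.update_self, hself, hself, hval]
        -- in a population of at least two, the state `D` is the better one for the player herself
        have hCD : defectValue β m (Function.update x m .D) - defectValue β m x ≤
            defectValue β m (Function.update x m .C) - defectValue β m x := by
          have : 0 ≤ (1 - 2 / N : ℝ) / (β + 1) := by
            have : (2 : ℝ) / N ≤ 1 := (div_le_one hN0).2 hNr
            exact div_nonneg (by linarith) (by linarith)
          rw [defectValue_update_sub, defectValue_update_sub]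
          simp only [if_true, reduceCtorEq, if_false, mul_div_assoc]
          nlinarith
        rw [eq_sub_of_add_eq' hsum]
        nlinarith
      · have hupd : ¬ ∀ k, k ≠ n → Function.update x m .D k = .C := fun h => by
          simpa using h m hm
        simp only [Choice.sum_eq, Function.update_of_ne hm, triggerStrategy_prob_of_ne hC,
          reduceCtorEq, if_true, if_false, zero_mul, one_mul, zero_add, hval]
        rw [deviationValue, if_neg hupd]
    have hsum := Finset.sum_le_sum fun m (_ : m ∈ Finset.univ) => hterm m
    rw [sum_defectValue_update_sub] at hsum
    rw [hval] at hsum ⊢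
    rw [mul_defectValue hβ]
    linarith

/-- The cost of a player when everybody uses the trigger strategy. -/
theorem eq_triggerValue {ξ : Fin N → Choice} {n : Fin N} {v : ℝ}
    (h : (prisonersDilemma β hβ m₀ hm₀).HasPlayerCost ξ n triggerStrategy triggerStrategy v) :
    v = triggerValue β n ξ := by
  have : NeZero N := ⟨by have := n.2; omega⟩
  obtain ⟨_, Ω, _, P, X, hX, rfl⟩ := h
  rw [Function.update_eq_self_iff.2 rfl] at hX
  rw [← hX.integral_discounted_generator (triggerValue β n)]
  simp only [sum_prob_mul_cost]
  congr 1 with ω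
  congr 1 with t
  rw [← triggerValue_equation (hβ := hβ) (m₀ := m₀) (hm₀ := hm₀) n t]
  rfl

theorem deviationValue_le (hβ1 : β < 1) (hN2 : 2 ≤ N)
    (hN : β * (β + 1) / (1 - β) + 1 ≤ N) {ξ : Fin N → Choice} {n : Fin N}
    {π' : MarkovStrategy Choice Choice} {v : ℝ}
    (h : (prisonersDilemma β hβ m₀ hm₀).HasPlayerCost ξ n π' triggerStrategy v) :
    deviationValue β n ξ ≤ v := by
  have : NeZero N := ⟨by omega⟩
  obtain ⟨_, Ω, _, P, X, hX, rfl⟩ := h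
  obtain ⟨K, hK⟩ := exists_playerCost_bound n
  simp only [sum_prob_mul_cost]
  exact hX.le_integral_discounted (φ := fun _ => playerCost n) (fun _ => measurable_const)
    (fun _ => hK) (deviationValue_subsolution hβ1 hN2 hN n π')

theorem triggerStrategy_isMarkovEquilibrium (hβ1 : β < 1) (hN2 : 2 ≤ N)
    (hN : β * (β + 1) / (1 - β) + 1 ≤ N) (hD : m₀ .C ≠ 1 → 2 ≤ N * (1 - m₀ .C)) :
    (prisonersDilemma β hβ m₀ hm₀).IsMarkovEquilibrium N triggerStrategy := by
  intro ξ n π' v v' hv hv'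
  have : NeZero N := ⟨by omega⟩
  have hN0 : (0 : ℝ) < N := by positivity
  rw [eq_triggerValue hv]
  refine le_trans (le_of_eq ?_) (deviationValue_le hβ1 hN2 hN hv')
  have hξ : empirical ξ = m₀ := hv.1
  by_cases hall : ∀ m, ξ m = .C
  · rw [triggerValue, if_pos hall, deviationValue, if_pos fun m _ => hall m]
  · rw [triggerValue, if_neg hall, deviationValue, if_neg]
    intro hothers
    -- a single initial defector is ruled out by the size of the population
    have hC : m₀ .C ≠ 1 := by
      rw [← hξ]
      exact mt (empirical_C_eq_one_iff ξ).1 hall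
    have h2 := hD hC
    have hupd : ∀ m, Function.update ξ n .C m = .C := fun m => by
      by_cases hm : m = n
      · rw [hm, Function.update_self]
      · rw [Function.update_of_ne hm, hothers m hm]
    have h1 := (empirical_C_eq_one_iff _).2 hupd
    have hn : ξ n ≠ .C := fun hn => hall fun m => by
      by_cases hm : m = n
      · rw [hm, hn]
      · exact hothers m hm
    rw [empirical_update, hξ, if_pos rfl, if_neg hn] at h1
    have : (1 : ℝ) - m₀ .C = 1 / N := by linarith
    rw [this] at h2
    field_simp at h2
    norm_num at h2

/-- When all players cooperate, the trigger strategy keeps them in `C`, so that a constant process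
is the state evolution. -/
theorem isStateEvolution_const [NeZero N] :
    (prisonersDilemma β hβ m₀ hm₀).IsStateEvolution (fun _ : Fin N => triggerStrategy)
      (fun _ => .C) (Measure.dirac ()) fun _ _ _ => .C where
  isProbabilityMeasure := inferInstance
  measurable := measurable_const
  rightCont _ _ := by simp
  leftLim _ _ := ⟨_, Eventually.of_forall fun _ => rfl⟩
  initial := Eventually.of_forall fun _ => rfl
  martingale f := by
    have hgen : ∀ s, (prisonersDilemma β hβ m₀ hm₀).generator
        (fun _ : Fin N => triggerStrategy) s f (fun _ => .C) = 0 := by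
      intro s
      have hC := (empirical_C_eq_one_iff (fun _ : Fin N => Choice.C)).2 fun _ => rfl
      rw [generator_eq]
      refine Finset.sum_eq_zero fun m _ => ?_
      simp [triggerStrategy_prob_of_eq hC]
    simp only [hgen, intervalIntegral.integral_zero, sub_zero]
    exact martingale_const _ _ _

theorem hasPlayerCost_trigger_iff (n : Fin N) (v : ℝ) :
    (prisonersDilemma β hβ allCooperate allCooperate_mem).HasPlayerCost (fun _ => Choice.C) n
      triggerStrategy triggerStrategy v ↔ v = 1 / β := by
  have : NeZero N := ⟨by have := n.2; omega⟩
  have hval : triggerValue β n (fun _ => .C) = 1 / β := by simp [triggerValue]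
  refine ⟨fun h => (eq_triggerValue h).trans hval, ?_⟩
  have hex : ∃ w, (prisonersDilemma β hβ allCooperate allCooperate_mem).HasPlayerCost
      (fun _ => Choice.C) n triggerStrategy triggerStrategy w := by
    refine ⟨_, empirical_const_C, Unit, inferInstance, Measure.dirac (), fun _ _ _ => .C, ?_, rfl⟩
    rw [Function.update_eq_self_iff.2 rfl]
    exact isStateEvolution_const
  obtain ⟨w, hw⟩ := hex
  rintro rfl
  rwa [← hval, ← eq_triggerValue hw]

end PrisonersDilemma

/-! ### The mean field game -/

theorem hasDerivAt_integral_of_continuousOn_Ici {f : ℝ → ℝ} (hf : ContinuousOn f (Ici 0))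
    {s : ℝ} (hs : 0 < s) : HasDerivAt (fun t => ∫ r in (0 : ℝ)..t, f r) (f s) s :=
  intervalIntegral.integral_hasDerivAt_right
    (hf.mono (by rw [uIcc_of_le hs.le]; exact Icc_subset_Ici_self)).intervalIntegrable
    (hf.mono Ioi_subset_Ici_self |>.stronglyMeasurableAtFilter isOpen_Ioi s hs)
    (hf.continuousAt (Ici_mem_nhds hs))

/-- A Grönwall inequality: if the primitive `z` of `f` satisfies `z' ≤ -k (z - c)`, then `z - c`
is at most the solution `-c e^{-kt}` of the linear equation. -/
theorem exp_mul_integral_sub_le {f : ℝ → ℝ} (hf : ContinuousOn f (Ici 0)) {k c t : ℝ} (ht : 0 ≤ t)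
    (h : ∀ s ∈ Ioo 0 t, f s + k * ((∫ r in (0 : ℝ)..s, f r) - c) ≤ 0) :
    Real.exp (k * t) * ((∫ r in (0 : ℝ)..t, f r) - c) ≤ -c := by
  let w : ℝ → ℝ := fun s => Real.exp (k * s) * ((∫ r in (0 : ℝ)..s, f r) - c)
  have hsub : uIcc 0 t ⊆ Ici 0 := by
    rw [uIcc_of_le ht]
    exact Icc_subset_Ici_self
  have hcont : ContinuousOn w (Icc 0 t) := by
    have h1 := intervalIntegral.continuousOn_primitive_interval' (μ := volume)
      (hf.mono hsub).intervalIntegrable left_mem_uIcc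
    rw [uIcc_of_le ht] at h1
    exact ContinuousOn.mul (by fun_prop) (h1.sub continuousOn_const)
  have hderiv : ∀ s ∈ Ioo 0 t, HasDerivAt w
      (Real.exp (k * s) * (f s + k * ((∫ r in (0 : ℝ)..s, f r) - c))) s := by
    intro s hs
    have h1 : HasDerivAt (fun s => Real.exp (k * s)) (Real.exp (k * s) * (k * 1)) s :=
      ((hasDerivAt_id s).const_mul k).exp
    convert! h1.mul ((hasDerivAt_integral_of_continuousOn_Ici hf hs.1).sub_const c) using 1
    ring
  have hanti : AntitoneOn w (Icc 0 t) := by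
    refine antitoneOn_of_deriv_nonpos (convex_Icc 0 t) hcont ?_ ?_ <;> rw [interior_Icc]
    · exact fun s hs => (hderiv s hs).differentiableAt.differentiableWithinAt
    · intro s hs
      rw [(hderiv s hs).deriv]
      exact mul_nonpos_of_nonneg_of_nonpos (Real.exp_pos _).le (h s hs)
  simpa [w] using hanti (left_mem_Icc.2 ht) (right_mem_Icc.2 ht) ht

theorem LocalStrategy.prob_le_one {E A : Type} [Fintype A] (π : LocalStrategy E A) (i : E) (t : ℝ)
    (a : A) : π.prob i t a ≤ 1 :=
  (Finset.single_le_sum (fun b _ => π.nonneg i t b) (Finset.mem_univ a)).trans_eq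
    (π.sum_eq_one i t)

namespace PrisonersDilemma

open MeanFieldGame

variable {β : ℝ} {hβ : 0 < β} {m₀ : Choice → ℝ} {hm₀ : m₀ ∈ stdSimplex ℝ Choice}

/-- The probability that a player with state distribution `x t` who is chosen at time `t`
cooperates when she uses the strategy `π`. -/
noncomputable def cooperation (π : LocalStrategy Choice Choice) (x : ℝ → Choice → ℝ) (t : ℝ) : ℝ :=
  x t .C * π.prob .C t .C + x t .D * π.prob .D t .C

section Flow

variable {π : LocalStrategy Choice Choice} {m x : ℝ → Choice → ℝ}

theorem drift_C (t : ℝ) :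
    ∑ i, ∑ a, x t i * (prisonersDilemma β hβ m₀ hm₀).Q i .C a (m t) * π.prob i t a =
      cooperation π x t - x t .C := by
  have h := π.sum_eq_one .C t
  simp only [Choice.sum_eq] at h ⊢
  simp only [prisonersDilemma, cooperation, reduceCtorEq, if_true, if_false]
  linear_combination (-x t .C) * h

theorem drift_D (t : ℝ) :
    ∑ i, ∑ a, x t i * (prisonersDilemma β hβ m₀ hm₀).Q i .D a (m t) * π.prob i t a =
      x t .C - cooperation π x t := by
  have h := π.sum_eq_one .C t
  simp only [Choice.sum_eq] at h ⊢
  simp only [prisonersDilemma, cooperation, reduceCtorEq, if_true, if_false]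
  linear_combination (x t .C) * h

theorem apply_D {y : Choice → ℝ} (hy : y ∈ stdSimplex ℝ Choice) : y .D = 1 - y .C := by
  have := hy.2
  rw [Choice.sum_eq] at this
  linarith

theorem apply_C_le_one {y : Choice → ℝ} (hy : y ∈ stdSimplex ℝ Choice) : y .C ≤ 1 := by
  have := hy.1 .D
  rw [apply_D hy] at this
  linarith

theorem cooperation_nonneg (π : LocalStrategy Choice Choice) {t : ℝ}
    (hxt : x t ∈ stdSimplex ℝ Choice) : 0 ≤ cooperation π x t :=
  add_nonneg (mul_nonneg (hxt.1 _) (π.nonneg _ _ _)) (mul_nonneg (hxt.1 _) (π.nonneg _ _ _))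

theorem flow_continuousOn
    (hx : (prisonersDilemma β hβ m₀ hm₀).IsPlayerFlow π m x)
    (i : Choice) : ContinuousOn (fun t => x t i) (Ici 0) :=
  (continuous_apply i).comp_continuousOn hx.continuousOn

theorem flow_intervalIntegrable
    (hx : (prisonersDilemma β hβ m₀ hm₀).IsPlayerFlow π m x)
    (i : Choice) {t : ℝ} (ht : 0 ≤ t) :
    IntervalIntegrable (fun s => x s i) volume 0 t :=
  ((flow_continuousOn hx i).mono (by rw [uIcc_of_le ht]; exact Icc_subset_Ici_self)).intervalIntegrable

theorem flow_mul_prob_intervalIntegrable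
    (hx : (prisonersDilemma β hβ m₀ hm₀).IsPlayerFlow π m x)
    (i j a : Choice) {t : ℝ} (ht : 0 ≤ t) :
    IntervalIntegrable (fun s => x s i * π.prob j s a) volume 0 t := by
  have h := flow_intervalIntegrable hx i ht
  rw [intervalIntegrable_iff] at h ⊢
  refine h.mul_bdd (c := 1) (π.measurable j a).aestronglyMeasurable (Eventually.of_forall fun s => ?_)
  rw [Real.norm_eq_abs, abs_of_nonneg (π.nonneg _ _ _)]
  exact π.prob_le_one _ _ _

theorem cooperation_intervalIntegrable
    (hx : (prisonersDilemma β hβ m₀ hm₀).IsPlayerFlow π m x)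
    {t : ℝ} (ht : 0 ≤ t) :
    IntervalIntegrable (cooperation π x) volume 0 t :=
  (flow_mul_prob_intervalIntegrable hx .C .C .C ht).add
    (flow_mul_prob_intervalIntegrable hx .D .D .C ht)

theorem flow_C_eq
    (hx : (prisonersDilemma β hβ m₀ hm₀).IsPlayerFlow π m x)
    {t : ℝ} (ht : 0 ≤ t) :
    x t .C = m₀ .C + (∫ s in (0 : ℝ)..t, cooperation π x s) - ∫ s in (0 : ℝ)..t, x s .C := by
  rw [hx.eq t ht .C]
  simp only [drift_C]
  rw [intervalIntegral.integral_sub (cooperation_intervalIntegrable hx ht)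
    (flow_intervalIntegrable hx .C ht), ← add_sub_assoc]
  rfl

theorem integral_cooperation_mono (hx : (prisonersDilemma β hβ m₀ hm₀).IsPlayerFlow π m x)
    {s t : ℝ} (hs : 0 ≤ s) (hst : s ≤ t) :
    ∫ r in (0 : ℝ)..s, cooperation π x r ≤ ∫ r in (0 : ℝ)..t, cooperation π x r := by
  refine intervalIntegral.integral_mono_interval le_rfl hs hst ?_
    (cooperation_intervalIntegrable hx (hs.trans hst))
  filter_upwards [ae_restrict_mem measurableSet_Ioc] with r hr
  exact cooperation_nonneg π (hx.mem r hr.1.le)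

/-- No strategy brings a player out of state `C` faster than always defecting does, and a strategy
that cooperates with positive probability is strictly slower. -/
theorem exp_mul_le_flow_C (hx : (prisonersDilemma β hβ m₀ hm₀).IsPlayerFlow π m x)
    {t : ℝ} (ht : 0 ≤ t) :
    (m₀ .C + ∫ s in (0 : ℝ)..t, cooperation π x s) * Real.exp (-t) ≤ x t .C := by
  have h := exp_mul_integral_sub_le (k := 1) (c := m₀ .C + ∫ s in (0 : ℝ)..t, cooperation π x s)
    (flow_continuousOn hx .C) ht fun s hs => by
      rw [flow_C_eq hx hs.1.le]
      linarith [integral_cooperation_mono hx hs.1.le hs.2.le]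
  rw [flow_C_eq hx ht, Real.exp_neg, ← div_eq_mul_inv, div_le_iff₀ (Real.exp_pos t)]
  rw [one_mul] at h
  linarith

/-- The Kolmogorov equation determines the state distribution. As the transition rates do not
depend on the population distribution, the latter may differ. -/
theorem flow_unique (hx : (prisonersDilemma β hβ m₀ hm₀).IsPlayerFlow π m x) {m' y : ℝ → Choice → ℝ}
    (hy : (prisonersDilemma β hβ m₀ hm₀).IsPlayerFlow π m' y) {t : ℝ} (ht : 0 ≤ t) :
    x t = y t := by
  let d : ℝ → ℝ := fun s => |x s .C - y s .C|
  have hd : ContinuousOn d (Ici 0) :=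
    ((flow_continuousOn hx .C).sub (flow_continuousOn hy .C)).abs
  have hbound : ∀ s, 0 ≤ s → d s ≤ 2 * ∫ r in (0 : ℝ)..s, d r := by
    intro s hs
    have heq : x s .C - y s .C = ∫ r in (0 : ℝ)..s,
        ((cooperation π x r - x r .C) - (cooperation π y r - y r .C)) := by
      rw [intervalIntegral.integral_sub
          ((cooperation_intervalIntegrable hx hs).sub (flow_intervalIntegrable hx .C hs))
          ((cooperation_intervalIntegrable hy hs).sub (flow_intervalIntegrable hy .C hs)),
        intervalIntegral.integral_sub (cooperation_intervalIntegrable hx hs)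
          (flow_intervalIntegrable hx .C hs),
        intervalIntegral.integral_sub (cooperation_intervalIntegrable hy hs)
          (flow_intervalIntegrable hy .C hs), flow_C_eq hx hs, flow_C_eq hy hs]
      ring
    rw [← intervalIntegral.integral_const_mul]
    simp only [d]
    rw [heq, ← Real.norm_eq_abs]
    refine intervalIntegral.norm_integral_le_of_norm_le hs ?_ ?_
    · refine Eventually.of_forall fun r hr => ?_
      have hxD := apply_D (hx.mem r hr.1.le)
      have hyD := apply_D (hy.mem r hr.1.le)
      have hp : |π.prob .C r .C - π.prob .D r .C - 1| ≤ 2 := by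
        rw [abs_le]
        constructor <;> linarith [π.nonneg .C r .C, π.nonneg .D r .C, π.prob_le_one .C r .C,
          π.prob_le_one .D r .C]
      have : cooperation π x r - x r .C - (cooperation π y r - y r .C) =
          (π.prob .C r .C - π.prob .D r .C - 1) * (x r .C - y r .C) := by
        rw [cooperation, cooperation, hxD, hyD]
        ring
      rw [this, Real.norm_eq_abs, abs_mul]
      exact mul_le_mul_of_nonneg_right hp (abs_nonneg _)
    · exact ((hd.mono (by rw [uIcc_of_le hs]; exact Icc_subset_Ici_self)).intervalIntegrable).const_mul 2
  have h := exp_mul_integral_sub_le (k := -2) (c := 0) hd ht fun s hs => by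
    linarith [hbound s hs.1.le]
  have h0 : ∫ r in (0 : ℝ)..t, d r ≤ 0 := by
    rw [sub_zero, neg_zero] at h
    exact nonpos_of_mul_nonpos_right h (Real.exp_pos _)
  have hC : x t .C = y t .C := by
    have h1 := hbound t ht
    have h2 : |x t .C - y t .C| ≤ 0 := by
      simp only [d] at h1 h0
      linarith
    exact sub_eq_zero.1 (abs_nonpos_iff.1 h2)
  ext i
  cases i
  · exact hC
  · rw [apply_D (hx.mem t ht), apply_D (hy.mem t ht), hC]

end Flow

/-- The state distribution of a player who always defects: the mass of `C` decays at rate `1`. -/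
noncomputable def defectFlow (m₀ : Choice → ℝ) (t : ℝ) : Choice → ℝ
  | .C => m₀ .C * Real.exp (-t)
  | .D => 1 - m₀ .C * Real.exp (-t)

theorem defectFlow_isPlayerFlow (m : ℝ → Choice → ℝ) :
    (prisonersDilemma β hβ m₀ hm₀).IsPlayerFlow alwaysDefect m (defectFlow m₀) where
  mem t ht := by
    have h1 : Real.exp (-t) ≤ 1 := Real.exp_le_one_iff.2 (by linarith)
    have h2 := mul_le_mul_of_nonneg_left h1 (hm₀.1 .C)
    refine ⟨fun i => ?_, ?_⟩
    · cases i
      · exact mul_nonneg (hm₀.1 .C) (Real.exp_pos _).le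
      · simp only [defectFlow]
        linarith [apply_C_le_one hm₀]
    · simp [Choice.sum_eq, defectFlow]
  continuousOn := by
    refine Continuous.continuousOn (continuous_pi fun i => ?_)
    cases i <;> simp only [defectFlow] <;> fun_prop
  eq t ht j := by
    have hu : ∀ s, cooperation alwaysDefect (defectFlow m₀) s = 0 := fun s => by
      simp [cooperation, alwaysDefect]
    have hint : ∫ s in (0 : ℝ)..t, m₀ .C * Real.exp (-s) = m₀ .C - m₀ .C * Real.exp (-t) := by
      rw [intervalIntegral.integral_eq_sub_of_hasDerivAt (f := fun s => -(m₀ .C * Real.exp (-s)))]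
      · simp
        ring
      · intro s _
        convert! (((hasDerivAt_id s).neg.exp).const_mul (m₀ .C)).neg using 1
        simp
      · exact Continuous.intervalIntegrable (by fun_prop) _ _
    have hC : ∀ s, defectFlow m₀ s .C = m₀ .C * Real.exp (-s) := fun _ => rfl
    have hD : defectFlow m₀ t .D = 1 - m₀ .C * Real.exp (-t) := rfl
    cases j
    · simp only [drift_C, hu, zero_sub, hC, intervalIntegral.integral_neg, hint]
      simp [prisonersDilemma]
    · simp only [drift_D, hu, sub_zero, hC, hD, hint]
      have := apply_D hm₀
      simp only [prisonersDilemma]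
      linarith

/-- The cost does not depend on the actions, and it separates the state of the player from that
of the population. -/
theorem discountedCost_eq {π π' : LocalStrategy Choice Choice} {m m' x : ℝ → Choice → ℝ}
    (hm : (prisonersDilemma β hβ m₀ hm₀).IsPlayerFlow π' m' m)
    (hx : (prisonersDilemma β hβ m₀ hm₀).IsPlayerFlow π m x) :
    (prisonersDilemma β hβ m₀ hm₀).discountedCost π m x =
      ∫ t in Ioi (0 : ℝ), (x t .C + 2 * (1 - m t .C)) * Real.exp (-(β * t)) := by
  refine setIntegral_congr_fun measurableSet_Ioi fun t ht => ?_
  have h1 := π.sum_eq_one .C t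
  have h2 := π.sum_eq_one .D t
  have h3 := apply_D (hx.mem t (le_of_lt ht))
  have h4 := apply_D (hm.mem t (le_of_lt ht))
  simp only [Choice.sum_eq] at h1 h2 ⊢
  simp only [prisonersDilemma, h3, h4]
  linear_combination Real.exp (-(β * t)) * (x t .C * (m t .C + 3 * (1 - m t .C)) * h1 +
    (1 - x t .C) * (2 * (1 - m t .C)) * h2)

theorem integrableOn_cost {π π' : LocalStrategy Choice Choice} {m m' m'' x : ℝ → Choice → ℝ}
    (hm : (prisonersDilemma β hβ m₀ hm₀).IsPlayerFlow π' m' m)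
    (hx : (prisonersDilemma β hβ m₀ hm₀).IsPlayerFlow π m'' x) :
    IntegrableOn (fun t => (x t .C + 2 * (1 - m t .C)) * Real.exp (-(β * t))) (Ioi 0) := by
  refine (integrableOn_exp_neg_mul_Ioi hβ 0).bdd_mul (c := 3) ?_ ?_
  · refine ContinuousOn.aestronglyMeasurable ?_ measurableSet_Ioi
    exact ((flow_continuousOn hx .C).add (continuousOn_const.mul
      (continuousOn_const.sub (flow_continuousOn hm .C)))).mono Ioi_subset_Ici_self
  · filter_upwards [ae_restrict_mem measurableSet_Ioi] with t ht
    have h1 := hx.mem t (le_of_lt ht)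
    have h2 := hm.mem t (le_of_lt ht)
    rw [Real.norm_eq_abs, abs_le]
    constructor <;> linarith [h1.1 .C, h2.1 .C, apply_C_le_one h1, apply_C_le_one h2]

theorem alwaysDefect_isMeanFieldEquilibrium :
    (prisonersDilemma β hβ m₀ hm₀).IsMeanFieldEquilibrium alwaysDefect := by
  have hd := defectFlow_isPlayerFlow (hβ := hβ) (hm₀ := hm₀) (defectFlow m₀)
  refine ⟨defectFlow m₀, defectFlow m₀, hd, hd, fun π' y hy => ?_⟩
  rw [discountedCost_eq hd hd, discountedCost_eq hd hy]
  refine setIntegral_mono_on (integrableOn_cost hd hd) (integrableOn_cost hd hy)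
    measurableSet_Ioi fun t ht => ?_
  have h := exp_mul_le_flow_C hy (le_of_lt ht)
  have hU : 0 ≤ ∫ s in (0 : ℝ)..t, cooperation π' y s :=
    intervalIntegral.integral_nonneg (le_of_lt ht) fun s hs => cooperation_nonneg π' (hy.mem s hs.1)
  have h2 : defectFlow m₀ t .C ≤ y t .C := by
    refine le_trans ?_ h
    exact mul_le_mul_of_nonneg_right (by linarith) (Real.exp_pos _).le
  exact mul_le_mul_of_nonneg_right (by linarith) (Real.exp_pos _).le

theorem ae_eq_zero_of_forall_integral_eq_zero {u : ℝ → ℝ} (hu : ∀ t, 0 ≤ t → 0 ≤ u t)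
    (hint : ∀ t, 0 ≤ t → IntervalIntegrable u volume 0 t)
    (h : ∀ t, 0 ≤ t → ∫ s in (0 : ℝ)..t, u s = 0) : ∀ᵐ t : ℝ, 0 < t → u t = 0 := by
  have hn : ∀ n : ℕ, ∀ᵐ t : ℝ, t ∈ Ioc (0 : ℝ) n → u t = 0 := by
    intro n
    have h1 := h n (by positivity)
    have h2 := hint n (by positivity)
    rw [intervalIntegral.integral_of_le (by positivity), setIntegral_eq_zero_iff_of_nonneg_ae
      ((ae_restrict_mem measurableSet_Ioc).mono fun t ht => hu t ht.1.le)
      ((intervalIntegrable_iff_integrableOn_Ioc_of_le (by positivity)).1 h2)] at h1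
    exact (ae_restrict_iff' measurableSet_Ioc).1 h1
  filter_upwards [ae_all_iff.2 hn] with t ht h0
  obtain ⟨n, hn⟩ := exists_nat_ge t
  exact ht n ⟨h0, hn⟩

/-- In a mean field equilibrium, the cost of always defecting bounds the cost from above, which
forces the population to leave `C` at full speed. -/
theorem equilibrium_flow {π : LocalStrategy Choice Choice}
    (hπ : (prisonersDilemma β hβ m₀ hm₀).IsMeanFieldEquilibrium π) {m x : ℝ → Choice → ℝ}
    (hx : (prisonersDilemma β hβ m₀ hm₀).IsPlayerFlow π m x) :
    (∀ t, 0 < t → x t .C = m₀ .C * Real.exp (-t)) ∧ ∀ᵐ t : ℝ, 0 < t → cooperation π x t = 0 := by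
  obtain ⟨m', x', hm', hx', hopt⟩ := hπ
  have hd := defectFlow_isPlayerFlow (hβ := hβ) (hm₀ := hm₀) m'
  have hle := hopt alwaysDefect _ hd
  rw [discountedCost_eq hm' hx', discountedCost_eq hm' hd] at hle
  have hi1 := integrableOn_cost hm' hx'
  have hi2 := integrableOn_cost hm' hd
  have hpt : ∀ t ∈ Ioi (0 : ℝ), 0 ≤ (x' t .C + 2 * (1 - m' t .C)) * Real.exp (-(β * t)) -
      (defectFlow m₀ t .C + 2 * (1 - m' t .C)) * Real.exp (-(β * t)) := by
    intro t ht
    have h := exp_mul_le_flow_C hx' (le_of_lt ht)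
    have hU : 0 ≤ ∫ s in (0 : ℝ)..t, cooperation π x' s :=
      intervalIntegral.integral_nonneg (le_of_lt ht)
        fun s hs => cooperation_nonneg π (hx'.mem s hs.1)
    have h2 : defectFlow m₀ t .C ≤ x' t .C :=
      le_trans (mul_le_mul_of_nonneg_right (by linarith) (Real.exp_pos _).le) h
    exact sub_nonneg.2 (mul_le_mul_of_nonneg_right (by linarith) (Real.exp_pos _).le)
  have hnonneg : 0 ≤ᵐ[volume.restrict (Ioi 0)] fun t =>
      (x' t .C + 2 * (1 - m' t .C)) * Real.exp (-(β * t)) -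
      (defectFlow m₀ t .C + 2 * (1 - m' t .C)) * Real.exp (-(β * t)) :=
    (ae_restrict_mem measurableSet_Ioi).mono hpt
  have hzero := (integral_eq_zero_iff_of_nonneg_ae hnonneg (hi1.sub hi2)).1
    (le_antisymm (by rw [integral_sub hi1 hi2]; linarith) (integral_nonneg_of_ae hnonneg))
  have hae : (fun t => x' t .C) =ᵐ[volume.restrict (Ioi 0)] fun t => defectFlow m₀ t .C := by
    filter_upwards [hzero] with t ht
    rw [Pi.zero_apply, ← sub_mul] at ht
    linarith [(mul_eq_zero.1 ht).resolve_right (Real.exp_pos _).ne']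
  have heq : ∀ t, 0 < t → x' t .C = m₀ .C * Real.exp (-t) :=
    fun t ht => Measure.eqOn_open_of_ae_eq hae isOpen_Ioi
    ((flow_continuousOn hx' .C).mono Ioi_subset_Ici_self)
    ((flow_continuousOn hd .C).mono Ioi_subset_Ici_self) ht
  have hxx' : ∀ t, 0 ≤ t → x t = x' t := fun t ht => flow_unique hx hx' ht
  refine ⟨fun t ht => by rw [hxx' t ht.le, heq t ht], ?_⟩
  refine ae_eq_zero_of_forall_integral_eq_zero (fun t ht => cooperation_nonneg π (hx.mem t ht))
    (fun t ht => cooperation_intervalIntegrable hx ht) fun t ht => ?_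
  refine le_antisymm ?_ (intervalIntegral.integral_nonneg ht
    fun s hs => cooperation_nonneg π (hx.mem s hs.1))
  rcases ht.eq_or_lt with rfl | ht
  · simp
  · have h := exp_mul_le_flow_C hx ht.le
    rw [hxx' t ht.le, heq t ht] at h
    linarith [le_of_mul_le_mul_right h (Real.exp_pos _)]

theorem prob_eq_alwaysDefect {π : LocalStrategy Choice Choice} {i : Choice} {t : ℝ}
    (h : π.prob i t .C = 0) : π.prob i t = alwaysDefect.prob i t := by
  have hsum := π.sum_eq_one i t
  rw [Choice.sum_eq, h, zero_add] at hsum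
  ext a
  cases a
  · simpa [alwaysDefect] using h
  · simpa [alwaysDefect] using hsum

theorem ae_eq_alwaysDefect_of_pos {π : LocalStrategy Choice Choice}
    (hπ : (prisonersDilemma β hβ m₀ hm₀).IsMeanFieldEquilibrium π) {m : ℝ → Choice → ℝ}
    (hm : (prisonersDilemma β hβ m₀ hm₀).IsPopulationFlow π m) :
    ∀ᵐ t : ℝ, 0 ≤ t → ∀ i, 0 < m t i → π.prob i t = alwaysDefect.prob i t := by
  filter_upwards [(equilibrium_flow hπ hm).2, Measure.ae_ne volume 0] with t ht ht0 ht1 i hi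
  have h0 := ht (lt_of_le_of_ne ht1 ht0.symm)
  have hmem := hm.mem t ht1
  rw [cooperation, add_eq_zero_iff_of_nonneg (mul_nonneg (hmem.1 _) (π.nonneg _ _ _))
    (mul_nonneg (hmem.1 _) (π.nonneg _ _ _))] at h0
  refine prob_eq_alwaysDefect ?_
  cases i
  · exact (mul_eq_zero.1 h0.1).resolve_left hi.ne'
  · exact (mul_eq_zero.1 h0.2).resolve_left hi.ne'

theorem ae_eq_alwaysDefect {π : LocalStrategy Choice Choice}
    (hπ : (prisonersDilemma β hβ m₀ hm₀).IsMeanFieldEquilibrium π) (hC : 0 < m₀ .C) :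
    ∀ᵐ t : ℝ, 0 ≤ t → ∀ i, π.prob i t = alwaysDefect.prob i t := by
  obtain ⟨m, -, hm, -⟩ := id hπ
  filter_upwards [ae_eq_alwaysDefect_of_pos hπ hm, Measure.ae_ne volume 0] with t ht ht0 ht1 i
  have htpos : 0 < t := lt_of_le_of_ne ht1 ht0.symm
  refine ht ht1 i ?_
  have hmt := (equilibrium_flow hπ hm).1 t htpos
  cases i
  · rw [hmt]
    positivity
  · rw [apply_D (hm.mem t ht1), hmt]
    have h1 : Real.exp (-t) < 1 := Real.exp_lt_one_iff.2 (by linarith)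
    nlinarith [apply_C_le_one hm₀]

theorem integral_equilibrium_cost (hβ : 0 < β) :
    ∫ t in Ioi (0 : ℝ), (Real.exp (-t) + 2 * (1 - Real.exp (-t))) * Real.exp (-(β * t)) =
      (β + 2) / (β * (β + 1)) := by
  have hβ1 : 0 < β + 1 := by linarith
  have : ∀ t : ℝ, (Real.exp (-t) + 2 * (1 - Real.exp (-t))) * Real.exp (-(β * t)) =
      2 * Real.exp (-(β * t)) - Real.exp (-((β + 1) * t)) := by
    intro t
    have : Real.exp (-((β + 1) * t)) = Real.exp (-t) * Real.exp (-(β * t)) := by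
      rw [← Real.exp_add]
      ring_nf
    rw [this]
    ring
  simp only [this]
  rw [integral_sub ((integrableOn_exp_neg_mul_Ioi hβ 0).const_mul 2)
    (integrableOn_exp_neg_mul_Ioi hβ1 0), integral_const_mul, integral_exp_neg_mul_Ioi hβ,
    integral_exp_neg_mul_Ioi hβ1]
  simp only [mul_zero, neg_zero, Real.exp_zero]
  field_simp
  ring

theorem hasCost_equilibrium_iff {π : LocalStrategy Choice Choice}
    (hπ : (prisonersDilemma β hβ allCooperate allCooperate_mem).IsMeanFieldEquilibrium π) (w : ℝ) :
    (prisonersDilemma β hβ allCooperate allCooperate_mem).HasCost π π w ↔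
      w = (β + 2) / (β * (β + 1)) := by
  have hcost : ∀ m x, (prisonersDilemma β hβ allCooperate allCooperate_mem).IsPopulationFlow π m →
      (prisonersDilemma β hβ allCooperate allCooperate_mem).IsPlayerFlow π m x →
      (prisonersDilemma β hβ allCooperate allCooperate_mem).discountedCost π m x =
        (β + 2) / (β * (β + 1)) := by
    intro m x hm hx
    rw [discountedCost_eq hm hx, ← integral_equilibrium_cost hβ]
    refine setIntegral_congr_fun measurableSet_Ioi fun t ht => ?_
    have h1 : x t .C = Real.exp (-t) := by
      rw [(equilibrium_flow hπ hx).1 t ht]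
      simp [allCooperate]
    have h2 : m t .C = Real.exp (-t) := by
      rw [(equilibrium_flow hπ hm).1 t ht]
      simp [allCooperate]
    simp only [h1, h2]
  constructor
  · rintro ⟨m, x, hm, hx, rfl⟩
    exact hcost m x hm hx
  · rintro rfl
    obtain ⟨m, x, hm, hx, -⟩ := id hπ
    exact ⟨m, x, hm, hx, (hcost m x hm hx).symm⟩

end PrisonersDilemma

/-! ### Equilibria and the limit of their costs -/

theorem mainTheorem5 :
    -- always playing `D` is the unique mean field equilibrium
    (∀ (β : ℝ) (hβ : 0 < β) (m₀ : Choice → ℝ) (hm₀ : m₀ ∈ stdSimplex ℝ Choice),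
      (prisonersDilemma β hβ m₀ hm₀).IsMeanFieldEquilibrium alwaysDefect ∧
      ∀ π : LocalStrategy Choice Choice,
        (prisonersDilemma β hβ m₀ hm₀).IsMeanFieldEquilibrium π →
          (∀ m, (prisonersDilemma β hβ m₀ hm₀).IsPopulationFlow π m →
            ∀ᵐ t : ℝ, 0 ≤ t → ∀ i, 0 < m t i → π.prob i t = alwaysDefect.prob i t) ∧
          (0 < m₀ Choice.C →
            ∀ᵐ t : ℝ, 0 ≤ t → ∀ i, π.prob i t = alwaysDefect.prob i t)) ∧
    -- the trigger strategy is a Markov equilibrium of the game with `N` players, `N` large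
    (∀ (β : ℝ) (hβ : 0 < β), β < 1 →
      ∀ (m₀ : Choice → ℝ) (hm₀ : m₀ ∈ stdSimplex ℝ Choice),
        ∃ N₀ : ℕ, ∀ N ≥ N₀,
          (prisonersDilemma β hβ m₀ hm₀).IsMarkovEquilibrium N triggerStrategy) ∧
    -- when everybody cooperates initially, the equilibrium costs do not converge
    (∀ (β : ℝ) (hβ : 0 < β), β < 1 →
      (∀ (N : ℕ) (n : Fin N) (v : ℝ),
        (prisonersDilemma β hβ allCooperate allCooperate_mem).HasPlayerCost (fun _ => Choice.C) n
          triggerStrategy triggerStrategy v ↔ v = 1 / β) ∧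
      (∀ π : LocalStrategy Choice Choice,
        (prisonersDilemma β hβ allCooperate allCooperate_mem).IsMeanFieldEquilibrium π → ∀ w : ℝ,
          ((prisonersDilemma β hβ allCooperate allCooperate_mem).HasCost π π w ↔
            w = (β + 2) / (β * (β + 1)))) ∧
      ∀ (v : ℕ → ℝ) (w : ℝ),
        (∀ᶠ N in Filter.atTop, ∃ n : Fin N,
          (prisonersDilemma β hβ allCooperate allCooperate_mem).HasPlayerCost (fun _ => Choice.C) n
            triggerStrategy triggerStrategy (v N)) →
        (∃ π : LocalStrategy Choice Choice,
          (prisonersDilemma β hβ allCooperate allCooperate_mem).IsMeanFieldEquilibrium π ∧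
          (prisonersDilemma β hβ allCooperate allCooperate_mem).HasCost π π w) →
        ¬ Filter.Tendsto v Filter.atTop (𝓝 w)) := by 
  refine ⟨fun β hβ m₀ hm₀ => ⟨PrisonersDilemma.alwaysDefect_isMeanFieldEquilibrium, fun π hπ =>
    ⟨fun m hm => PrisonersDilemma.ae_eq_alwaysDefect_of_pos hπ hm,
      PrisonersDilemma.ae_eq_alwaysDefect hπ⟩⟩, fun β hβ hβ1 m₀ hm₀ => ?_, fun β hβ hβ1 =>
    ⟨fun N n v => PrisonersDilemma.hasPlayerCost_trigger_iff n v,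
      fun π hπ w => PrisonersDilemma.hasCost_equilibrium_iff hπ w, ?_⟩⟩
  · have h1 : 0 ≤ β * (β + 1) / (1 - β) := div_nonneg (by positivity) (by linarith)
    -- the last summand provides two initial defectors; it is the junk value `0` if `m₀ .C = 1`
    refine ⟨2 + ⌈β * (β + 1) / (1 - β)⌉₊ + ⌈2 / (1 - m₀ .C)⌉₊, fun N hN => ?_⟩
    have hNr : (2 + ⌈β * (β + 1) / (1 - β)⌉₊ + ⌈2 / (1 - m₀ .C)⌉₊ : ℝ) ≤ N := by
      exact_mod_cast hN
    have h2 := Nat.le_ceil (β * (β + 1) / (1 - β))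
    have h3 := Nat.le_ceil (2 / (1 - m₀ .C))
    refine PrisonersDilemma.triggerStrategy_isMarkovEquilibrium hβ1 (by omega) ?_ fun hC => ?_
    · linarith [(Nat.cast_nonneg ⌈2 / (1 - m₀ .C)⌉₊ : (0 : ℝ) ≤ _)]
    · have hlt : 0 < 1 - m₀ .C :=
        sub_pos.2 (lt_of_le_of_ne (PrisonersDilemma.apply_C_le_one hm₀) hC)
      rw [← div_le_iff₀ hlt]
      linarith
  · rintro v w hv ⟨π, hπ, hw⟩ hlim
    have hv' : v =ᶠ[Filter.atTop] fun _ => 1 / β := by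
      filter_upwards [hv] with N hN
      obtain ⟨n, hn⟩ := hN
      exact (PrisonersDilemma.hasPlayerCost_trigger_iff n _).1 hn
    have hw1 := tendsto_nhds_unique hlim (tendsto_const_nhds.congr' hv'.symm)
    rw [(PrisonersDilemma.hasCost_equilibrium_iff hπ w).1 hw] at hw1
    field_simp at hw1
    linarith
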